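/- **Setting.** Let $\mathcal X,\mathcal Z$ be finite sets, let $p_X$ be a probability distribution on $\mathcal X$ and let $p_{KZ}$ be a probability distribution on $\mathcal X\times\mathcal Z$. All logarithms are natural; $H$ and $I$ denote Shannon entropy and mutual information. For each $n$ let $X^n$ have law $p_X^n=\prod_t p_X$ and let $(K^n,Z^n)$ have law $p_{KZ}^n=\prod_t p_{KZ}$. *Codes.* A source code of type $(n,m)$ is a pair of maps $\phi:\mathcal X^n\to\mathcal X^m$, surjective, and $\psi:\mathcal X^m\to\mathcal X^n$, one-to-one, such that $\psi(c)\in\phi^{-1}(c)$ for all $c\in\mathcal X^m$. A cryptosystem of type $(n,m)$ is a pair of maps $\Phi:\mathcal X^n\times\mathcal X^n\to\mathcal X^m$, $\Psi:\mathcal X^n\times\mathcal X^m\to\mathcal X^n$ for which there is a source code $(\phi,\psi)$ of type $(n,m)$ with $\Psi(k,\Phi(k,x))=\psi(\phi(x))$ for all $k,x\in\mathcal X^n$. Its decoding error probability is $p_{\rm e}=\Pr[\psi(\phi(X^n))\ne X^n]$. *Leakage.* For a map $\varphi_{\mathcal A}:\mathcal Z^n\to\mathcal M_{\mathcal A}$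 into a finite set, put $M_{\mathcal A}=\varphi_{\mathcal A}(Z^n)$ and $$\Delta_{\rm max\text{-}MI}(\Phi,\varphi_{\mathcal A})=\max I\big(\Phi(K^n,\overline X^n);\overline X^n\,\big|\,M_{\mathcal A}\big),$$ the maximum being over all distributions of $\overline X^n$ on $\mathcal X^n$, with $\overline X^n$ independent of $(K^n,Z^n)$. Let $\Delta_{\mathcal A}(\Phi,R_{\mathcal A})$ be the maximum of $\Delta_{\rm max\text{-}MI}(\Phi,\varphi_{\mathcal A})$ over all $\varphi_{\mathcal A}$ with $|\mathcal M_{\mathcal A}|\le e^{nR_{\mathcal A}}$. *System region.* $\mathcal R_{\rm Sys}(\varepsilon,\delta|p_X,p_{KZ})$ is the set of pairs $(R_{\mathcal A},R)$ with $R_{\mathcal A}>0$ for which there are cryptosystems $(\Phi^{(n)},\Psi^{(n)})$ of types $(n,m_n)$ such that for every $\gamma>0$ there is $n_0$ such that for all $n\ge n_0$ $$\tfrac{m_n}{n}\log|\mathcal X|\in[R-\gamma,R+\gamma],\qquad p_{\rm e}\le\delta,\qquad \Delta_{\mathcal A}(\Phi^{(n)},R_{\mathcal A})\le\varepsilon .$$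 *One-helper region.* $\mathcal R_{\rm AKW}(p_{KZ})$ is the set of $(R_{\mathcal A},R)\in\mathbb R_+^2=[0,\infty)^2$ for which there is a random variable $U$, with at most $|\mathcal Z|+1$ values and with $U\leftrightarrow Z\leftrightarrow K$ a Markov chain, where $(K,Z)\sim p_{KZ}$, such that $R_{\mathcal A}\ge I(Z;U)$ and $R\ge H(K|U)$. **Theorem.** Let $\varepsilon_0>0$. For every $(\varepsilon,\delta)\in(0,\varepsilon_0]\times(0,1)$, $$\mathcal R_{\rm Sys}(\varepsilon,\delta|p_X,p_{KZ})\subseteq{\rm cl}\big[\mathcal R_{\rm AKW}^{\rm c}(p_{KZ})\big],$$ where the complement is taken in $\mathbb R^2$. If moreover $X$ is not deterministic (that is, $p_X(x)\ne1$ for all $x$), the same inclusion holds with the complement taken in $\mathbb R_+^2$. -/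

import Mathlib

open Set

namespace SideChannel

noncomputable section

/-! ### Information measures on finite probability spaces (natural logarithm)

A probability distribution on a finite type `Ω` is an element of `stdSimplex ℝ Ω`;
a random variable is a function on `Ω`. -/

section Information

open Classical in
/-- The law of the random variable `f` when the underlying distribution is `p`:
`law p f a = Pr[f = a]`. -/
def law {Ω α : Type*} [Fintype Ω] (p : Ω → ℝ) (f : Ω → α) (a : α) : ℝ :=
  ∑ ω, if f ω = a then p ω else 0

/-- The conditional entropy `H(A | B)`
(terms with `Pr[A = a, B = b] = 0` contribute `0`). -/
def condEntropy {Ω α β : Type*} [Fintype Ω] [Fintype α] [Fintype β]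
    (p : Ω → ℝ) (A : Ω → α) (B : Ω → β) : ℝ :=
  - ∑ a, ∑ b, law p (fun ω => (A ω, B ω)) (a, b) *
      Real.log (law p (fun ω => (A ω, B ω)) (a, b) / law p B b)

/-- The mutual information `I(A ; B)`. -/
def mutualInfo {Ω α β : Type*} [Fintype Ω] [Fintype α] [Fintype β]
    (p : Ω → ℝ) (A : Ω → α) (B : Ω → β) : ℝ :=
  ∑ a, ∑ b, law p (fun ω => (A ω, B ω)) (a, b) *
    Real.log (law p (fun ω => (A ω, B ω)) (a, b) / (law p A a * law p B b))

/-- The conditional mutual information `I(A ; B | C)`. -/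
def condMutualInfo {Ω α β γ : Type*} [Fintype Ω] [Fintype α] [Fintype β] [Fintype γ]
    (p : Ω → ℝ) (A : Ω → α) (B : Ω → β) (C : Ω → γ) : ℝ :=
  ∑ a, ∑ b, ∑ c, law p (fun ω => (A ω, B ω, C ω)) (a, b, c) *
    Real.log (law p (fun ω => (A ω, B ω, C ω)) (a, b, c) * law p C c /
      (law p (fun ω => (A ω, C ω)) (a, c) * law p (fun ω => (B ω, C ω)) (b, c)))

/-- `A ↔ B ↔ C` is a Markov chain: `p(a,b,c) p(b) = p(a,b) p(b,c)`. -/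
def IsMarkovChain {Ω α β γ : Type*} [Fintype Ω]
    (p : Ω → ℝ) (A : Ω → α) (B : Ω → β) (C : Ω → γ) : Prop :=
  ∀ a b c, law p (fun ω => (A ω, B ω, C ω)) (a, b, c) * law p B b =
    law p (fun ω => (A ω, B ω)) (a, b) * law p (fun ω => (B ω, C ω)) (b, c)

end Information

section System

variable {𝒳 𝒵 : Type*}

/-- The memoryless law `p_X^n` of a source word. -/
def sourceLaw (pX : 𝒳 → ℝ) (n : ℕ) (x : Fin n → 𝒳) : ℝ :=
  ∏ t, pX (x t)

/-- The memoryless law `p_{KZ}^n` of a key word together with its channel output. -/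
def keyLaw (pKZ : 𝒳 × 𝒵 → ℝ) (n : ℕ) (k : Fin n → 𝒳) (z : Fin n → 𝒵) : ℝ :=
  ∏ t, pKZ (k t, z t)

variable (𝒳) in
/-- A source code `(φ, ψ)` without encryption: `φ` is surjective, `ψ` is one-to-one, and
`ψ` outputs an element of `φ⁻¹(c)` for every codeword `c`. -/
structure SourceCode (n m : ℕ) where
  φ : (Fin n → 𝒳) → (Fin m → 𝒳)
  ψ : (Fin m → 𝒳) → (Fin n → 𝒳)
  φ_surjective : Function.Surjective φ
  ψ_injective : Function.Injective ψ
  ψ_mem_preimage : ∀ c, φ (ψ c) = c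

variable (𝒳) in
/-- A cryptosystem `(Φ, Ψ)` (first argument: the key), together with a source code `(φ, ψ)` such
that `Ψ_k (Φ_k (x)) = ψ (φ (x))` for all keys `k` and all source words `x`. -/
structure Cryptosystem (n m : ℕ) where
  Φ : (Fin n → 𝒳) → (Fin n → 𝒳) → (Fin m → 𝒳)
  Ψ : (Fin n → 𝒳) → (Fin m → 𝒳) → (Fin n → 𝒳)
  base : SourceCode 𝒳 n m
  dec_enc : ∀ k x, Ψ k (Φ k x) = base.ψ (base.φ x)

variable [Fintype 𝒳] [Fintype 𝒵]

open Classical in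
/-- The decoding error probability `p_e(φ, ψ | p_X^n) = Pr[ψ(φ(X^n)) ≠ X^n]`. -/
def errorProb {n m : ℕ} (S : SourceCode 𝒳 n m) (pX : 𝒳 → ℝ) : ℝ :=
  ∑ x : Fin n → 𝒳, if S.ψ (S.φ x) ≠ x then sourceLaw pX n x else 0

/-- The joint law of `(K^n, Z^n, X̄^n)` where `X̄^n` has the arbitrary law `q` and is
independent of `(K^n, Z^n)`. -/
def jointLaw (pKZ : 𝒳 × 𝒵 → ℝ) (n : ℕ) (q : (Fin n → 𝒳) → ℝ) :
    (Fin n → 𝒳) × (Fin n → 𝒵) × (Fin n → 𝒳) → ℝ :=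
  fun ω => keyLaw pKZ n ω.1 ω.2.1 * q ω.2.2

/-- The leakage `I(C̄^m ; X̄^n | M_A)` for a source word `X̄^n` of law `q`, with
`C̄^m = Φ(K^n, X̄^n)` and `M_A = φ_A(Z^n)`. -/
def leakage (pKZ : 𝒳 × 𝒵 → ℝ) {n m k : ℕ} (Φ : (Fin n → 𝒳) → (Fin n → 𝒳) → (Fin m → 𝒳))
    (φA : (Fin n → 𝒵) → Fin k) (q : (Fin n → 𝒳) → ℝ) : ℝ :=
  condMutualInfo (jointLaw pKZ n q) (fun ω => Φ ω.1 ω.2.2) (fun ω => ω.2.2)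
    (fun ω => φA ω.2.1)

/-- The maximum mutual information criterion `Δ_{max-MI}`: the maximum of the leakage over all
laws of `X̄^n`. The maximum is taken in `EReal`, so that no boundedness has to be checked. -/
def maxLeakage (pKZ : 𝒳 × 𝒵 → ℝ) {n m k : ℕ} (Φ : (Fin n → 𝒳) → (Fin n → 𝒳) → (Fin m → 𝒳))
    (φA : (Fin n → 𝒵) → Fin k) : EReal :=
  ⨆ q ∈ stdSimplex ℝ (Fin n → 𝒳), (leakage pKZ Φ φA q : EReal)

/-- `Δ_A(Φ, R_A | p_{KZ}^n)`: the maximum of `Δ_{max-MI}` over all adversary encoders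
`φ_A : 𝒵^n → M_A` with `|M_A| ≤ e^{n R_A}`. -/
def adversaryLeakage (pKZ : 𝒳 × 𝒵 → ℝ) {n m : ℕ}
    (Φ : (Fin n → 𝒳) → (Fin n → 𝒳) → (Fin m → 𝒳)) (RA : ℝ) : EReal :=
  ⨆ (k : ℕ) (_ : (k : ℝ) ≤ Real.exp (n * RA)) (φA : (Fin n → 𝒵) → Fin k), maxLeakage pKZ Φ φA

/-- `R` is `(ε, δ)`-admissible under `R_A`. -/
def Admissible (ε δ : ℝ) (pX : 𝒳 → ℝ) (pKZ : 𝒳 × 𝒵 → ℝ) (RA R : ℝ) : Prop :=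
  ∃ (m : ℕ → ℕ) (S : ∀ n, Cryptosystem 𝒳 n (m n)), ∀ γ > 0, ∃ n₀ : ℕ, ∀ n ≥ n₀,
    (m n : ℝ) / n * Real.log (Fintype.card 𝒳) ∈ Icc (R - γ) (R + γ) ∧
    errorProb (S n).base pX ≤ δ ∧
    adversaryLeakage pKZ (S n).Φ RA ≤ (ε : EReal)

/-- The region `R_Sys(ε, δ | p_X, p_{KZ})` of pairs `(R_A, R)`, `R_A > 0`, such that `R` is
`(ε, δ)`-admissible under `R_A`. -/
def systemRegion (ε δ : ℝ) (pX : 𝒳 → ℝ) (pKZ : 𝒳 × 𝒵 → ℝ) : Set (ℝ × ℝ) :=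
  {r | 0 < r.1 ∧ Admissible ε δ pX pKZ r.1 r.2}

/-- The quadrant `ℝ₊²`. -/
def quadrant : Set (ℝ × ℝ) := {r | 0 ≤ r.1 ∧ 0 ≤ r.2}

/-- The set `P(p_{KZ})` of joint laws of `(U, Z, K)`, where `U` takes values in a set with
`a` elements (with `a ≤ |𝒵| + 1`), `(K, Z)` has law `p_{KZ}` and `U ↔ Z ↔ K`. -/
def auxLaws (pKZ : 𝒳 × 𝒵 → ℝ) (a : ℕ) : Set (Fin a × 𝒵 × 𝒳 → ℝ) :=
  {p | a ≤ Fintype.card 𝒵 + 1 ∧ p ∈ stdSimplex ℝ (Fin a × 𝒵 × 𝒳) ∧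
    law p (fun ω => (ω.2.2, ω.2.1)) = pKZ ∧
    IsMarkovChain p (fun ω => ω.1) (fun ω => ω.2.1) (fun ω => ω.2.2)}

/-- The one-helper (Ahlswede, Körner, Wyner) region `R_AKW(p_{KZ})`. -/
def akwRegion (pKZ : 𝒳 × 𝒵 → ℝ) : Set (ℝ × ℝ) :=
  {r | r ∈ quadrant ∧ ∃ a : ℕ, ∃ p ∈ auxLaws pKZ a,
    mutualInfo p (fun ω => ω.2.1) (fun ω => ω.1) ≤ r.1 ∧
    condEntropy p (fun ω => ω.2.2) (fun ω => ω.1) ≤ r.2}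

end System

end

end SideChannel

/-!
# The rate of a secure cryptosystem is not interior to the one-helper region

An adversary of rate `R_A` can run the encoder of the helper in the one-helper source coding
problem. Suppose that `(R_A, R)` exceeds strictly, in both coordinates, a pair `(R_A', R')` of the
one-helper region.

* *Leakage from below.* Let the source word be uniform on the range of the decoder. For every key
  the encryption map is then a bijection onto the cryptograms, so the cryptogram is uniform given
  the adversary's message, and the leakage is `m log |𝒳| - H(C | X̄, M)`. Once `X̄` is fixed, the
  cryptogram is a function of the key, hence the last term is at most `H(K | M)`, which is in turn
  at most the cross-entropy of the key relative to any kernel `Q`. By Gibbs' inequality this can be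
  shown in one step, `leakage_uniform_ge`, without defining the entropies involved.
* *The helper.* It remains to find an encoder with cross-entropy at most `n (R' + o(1))`. For a
  product kernel `∏ Q₁(k_t | u_t)` the cross-entropy is additive along the word; it is the expected
  distortion between the word `z` and the codeword `u` for the distortion measure
  `d(z, u) = E[-log Q₁(K | u) | Z = z]`. The Markov chain `U ↔ Z ↔ K` gives
  `E d(Z, U) = E[-log Q₁(K | U)]`, which is close to `H(K | U)` if `Q₁` is the conditional law mixed
  with a little of the uniform law (`exists_kernel_crossEntropy_lt`). So the encoder is supplied by
  the achievability part of rate-distortion theory, `eventually_exists_rateDistortion_code`, which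
  follows from Chernoff's bound (`exists_tail_le_pow`) and random covering (`exists_codebook`).

Together the leakage is at least `n (R - R' - o(1))`, which is unbounded (`Admissible.not_lt`).
So no point `(R_A - s, R - s)` with `s > 0` lies in the one-helper region, and letting `s` tend to
`0` proves the first inclusion. These points lie in the quadrant for small `s` if `R > 0`; when the
source is not deterministic, `R = 0` is impossible, since a code of rate `0` decodes correctly with
vanishing probability (`Admissible.rate_ne_zero`).
-/

namespace SideChannel

noncomputable section

/-! ### Laws of random variables on finite spaces -/

section Law

variable {Ω α β : Type*} [Fintype Ω]

theorem law_nonneg {p : Ω → ℝ} (hp : ∀ ω, 0 ≤ p ω) (f : Ω → α) (a : α) : 0 ≤ law p f a :=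
  Finset.sum_nonneg fun ω _ => by split_ifs <;> simp [hp ω]

/-- Change of variables for finite expectations. -/
theorem sum_law_mul [Fintype α] (p : Ω → ℝ) (f : Ω → α) (g : α → ℝ) :
    ∑ a, law p f a * g a = ∑ ω, p ω * g (f ω) := by
  classical
  simp only [law, Finset.sum_mul]
  rw [Finset.sum_comm]
  refine Finset.sum_congr rfl fun ω _ => ?_
  rw [Finset.sum_eq_single (f ω)]
  · simp
  · intro b _ hb
    simp [hb.symm]
  · simp

theorem sum_law [Fintype α] (p : Ω → ℝ) (f : Ω → α) : ∑ a, law p f a = ∑ ω, p ω := by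
  simpa using sum_law_mul p f fun _ => 1

theorem law_mem_stdSimplex [Fintype α] {p : Ω → ℝ} (hp : p ∈ stdSimplex ℝ Ω) (f : Ω → α) :
    law p f ∈ stdSimplex ℝ α :=
  ⟨law_nonneg hp.1 f, (sum_law p f).trans hp.2⟩

theorem sum_law_pair_right [Fintype β] (p : Ω → ℝ) (f : Ω → α) (g : Ω → β) (a : α) :
    ∑ b, law p (fun ω => (f ω, g ω)) (a, b) = law p f a := by
  classical
  simp only [law, Prod.mk.injEq]
  rw [Finset.sum_comm]
  refine Finset.sum_congr rfl fun ω _ => ?_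
  by_cases h : f ω = a <;> simp [h]

theorem sum_law_pair_left [Fintype α] (p : Ω → ℝ) (f : Ω → α) (g : Ω → β) (b : β) :
    ∑ a, law p (fun ω => (f ω, g ω)) (a, b) = law p g b := by
  classical
  simp only [law, Prod.mk.injEq]
  rw [Finset.sum_comm]
  refine Finset.sum_congr rfl fun ω _ => ?_
  by_cases h : g ω = b <;> simp [h]

end Law

/-- The pointwise form of Gibbs' inequality. -/
theorem sub_le_mul_log_div {a b : ℝ} (ha : 0 < a) (hb : 0 < b) : a - b ≤ a * Real.log (a / b) := by
  have h := Real.one_sub_inv_le_log_of_pos (div_pos ha hb)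
  have h2 := mul_le_mul_of_nonneg_left h ha.le
  have h3 : a * (1 - (a / b)⁻¹) = a - b := by field_simp
  linarith

/-! ### Leakage of a uniformly distributed codeword -/

section Leakage

variable {𝒳 𝒵 : Type*}

theorem Cryptosystem.enc_ψ_bijective [Fintype 𝒳] {n m : ℕ} (S : Cryptosystem 𝒳 n m)
    (k : Fin n → 𝒳) : Function.Bijective fun c => S.Φ k (S.base.ψ c) := by
  rw [← Finite.injective_iff_bijective]
  intro c c' h
  have h1 := S.dec_enc k (S.base.ψ c)
  have h2 := S.dec_enc k (S.base.ψ c')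
  rw [S.base.ψ_mem_preimage] at h1 h2
  simp only at h
  rw [h, h2] at h1
  exact (S.base.ψ_injective h1).symm

variable [Fintype 𝒳] [Fintype 𝒵]

omit [Fintype 𝒳] [Fintype 𝒵] in
theorem keyLaw_nonneg {pKZ : 𝒳 × 𝒵 → ℝ} (h : ∀ i, 0 ≤ pKZ i) (n : ℕ) (k : Fin n → 𝒳)
    (z : Fin n → 𝒵) : 0 ≤ keyLaw pKZ n k z :=
  Finset.prod_nonneg fun _ _ => h _

theorem sum_keyLaw {pKZ : 𝒳 × 𝒵 → ℝ} (h : pKZ ∈ stdSimplex ℝ (𝒳 × 𝒵)) (n : ℕ) :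
    ∑ k, ∑ z, keyLaw pKZ n k z = 1 := by
  classical
  rw [← Fintype.sum_prod_type' fun k z => keyLaw pKZ n k z,
    ← (Equiv.arrowProdEquivProdArrow (Fin n) (fun _ => 𝒳) (fun _ => 𝒵)).sum_comp]
  have := Fintype.sum_pow pKZ n
  rw [h.2, one_pow] at this
  rw [this]
  rfl

variable (𝒳) in
/-- The uniform distribution on the words of length `m`. -/
def uniformLaw (m : ℕ) : (Fin m → 𝒳) → ℝ := fun _ => ((Fintype.card 𝒳 : ℝ) ^ m)⁻¹

variable (𝒳) in
theorem uniformLaw_mem_stdSimplex [Nonempty 𝒳] (m : ℕ) :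
    uniformLaw 𝒳 m ∈ stdSimplex ℝ (Fin m → 𝒳) := by
  classical
  refine ⟨fun _ => by unfold uniformLaw; positivity, ?_⟩
  have : (Fintype.card 𝒳 : ℝ) ≠ 0 := by exact_mod_cast Fintype.card_ne_zero
  simp [uniformLaw, this]

theorem sum_jointLaw_mul (pKZ : 𝒳 × 𝒵 → ℝ) (n : ℕ) (q : (Fin n → 𝒳) → ℝ)
    (g : (Fin n → 𝒳) → (Fin n → 𝒵) → (Fin n → 𝒳) → ℝ) :
    ∑ ω, jointLaw pKZ n q ω * g ω.1 ω.2.1 ω.2.2 =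
      ∑ k, ∑ z, keyLaw pKZ n k z * ∑ x, q x * g k z x := by
  simp only [Fintype.sum_prod_type, jointLaw, Finset.mul_sum, mul_assoc]

open Classical in
theorem law_jointLaw {γ : Type*} (pKZ : 𝒳 × 𝒵 → ℝ) (n : ℕ) (q : (Fin n → 𝒳) → ℝ)
    (f : (Fin n → 𝒳) × (Fin n → 𝒵) × (Fin n → 𝒳) → γ) (c : γ) :
    law (jointLaw pKZ n q) f c =
      ∑ x, ∑ z, keyLaw pKZ n x z * ∑ x', q x' * if f (x, z, x') = c then 1 else 0 := by
  rw [← sum_jointLaw_mul pKZ n q fun x z x' => if f (x, z, x') = c then 1 else 0]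
  simp [law]

/-- If the source word is uniformly distributed on the decoder's range, then the cryptogram is
uniform and independent of the key, so the leakage is `m log |𝒳| - H(C | X̄, M)`. As `C` is a
function of the key once `X̄` is fixed, the entropy is at most the cross-entropy of the key
relative to any positive subprobability kernel `Q` from messages to keys. -/
theorem leakage_uniform_ge {pKZ : 𝒳 × 𝒵 → ℝ} (hp : pKZ ∈ stdSimplex ℝ (𝒳 × 𝒵)) {n m k : ℕ}
    [Nonempty 𝒳] (S : Cryptosystem 𝒳 n m) (φA : (Fin n → 𝒵) → Fin k)
    (Q : Fin k → (Fin n → 𝒳) → ℝ) (hQ : ∀ i x, 0 < Q i x) (hQ1 : ∀ i, ∑ x, Q i x ≤ 1) :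
    m * Real.log (Fintype.card 𝒳) + ∑ x, ∑ z, keyLaw pKZ n x z * Real.log (Q (φA z) x) ≤
      leakage pKZ S.Φ φA (law (uniformLaw 𝒳 m) S.base.ψ) := by
  classical
  set N : ℝ := (Fintype.card 𝒳 : ℝ) ^ m with hN
  have hNpos : 0 < N := pow_pos (by exact_mod_cast Fintype.card_pos) m
  set q := law (uniformLaw 𝒳 m) S.base.ψ with hqdef
  have hq : q ∈ stdSimplex ℝ (Fin n → 𝒳) := law_mem_stdSimplex (uniformLaw_mem_stdSimplex 𝒳 m) _
  set J := jointLaw pKZ n q with hJ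
  have hJ0 : ∀ ω, 0 ≤ J ω := fun ω => mul_nonneg (keyLaw_nonneg hp.1 _ _ _) (hq.1 _)
  have hJ1 : ∑ ω, J ω = 1 := by
    have := sum_jointLaw_mul pKZ n q fun _ _ _ => 1
    simpa [hq.2, sum_keyLaw hp] using this
  set C : (Fin n → 𝒳) × (Fin n → 𝒵) × (Fin n → 𝒳) → (Fin m → 𝒳) := fun ω => S.Φ ω.1 ω.2.2
    with hC
  set M : (Fin n → 𝒳) × (Fin n → 𝒵) × (Fin n → 𝒳) → Fin k := fun ω => φA ω.2.1 with hM
  set pM : Fin k → ℝ := law J M with hpM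
  have hpM0 : ∀ i, 0 ≤ pM i := law_nonneg hJ0 _
  have hpM' : ∀ i, pM i = ∑ x, ∑ z, keyLaw pKZ n x z * if φA z = i then 1 else 0 := by
    intro i
    rw [hpM, law_jointLaw]
    simp only [hM, ← Finset.sum_mul, hq.2, one_mul]
  have hCM : ∀ c i, law J (fun ω => (C ω, M ω)) (c, i) = pM i / N := by
    intro c i
    rw [law_jointLaw, hpM', Finset.sum_div]
    refine Finset.sum_congr rfl fun x _ => ?_
    rw [Finset.sum_div]
    refine Finset.sum_congr rfl fun z _ => ?_
    have h1 := sum_law_mul (uniformLaw 𝒳 m) S.base.ψ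
      fun x' => if S.Φ x x' = c then (1 : ℝ) else 0
    have h2 : ∑ c', uniformLaw 𝒳 m c' * (if S.Φ x (S.base.ψ c') = c then (1 : ℝ) else 0)
        = 1 / N := by
      have := (Equiv.ofBijective _ (S.enc_ψ_bijective x)).sum_comp
        fun c' => N⁻¹ * (if c' = c then (1 : ℝ) else 0)
      simp only [Equiv.ofBijective_apply] at this
      rw [show (∑ c', uniformLaw 𝒳 m c' * (if S.Φ x (S.base.ψ c') = c then (1 : ℝ) else 0)) = _
        from this]
      simp
    rw [h2] at h1
    by_cases h : φA z = i
    · simp only [hC, hM, Prod.mk.injEq, h, and_true, if_true, hqdef]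
      rw [h1]
      ring
    · simp [hM, h]
  have hXM : ∀ x i, law J (fun ω => (ω.2.2, M ω)) (x, i) = q x * pM i := by
    intro x i
    rw [law_jointLaw, hpM', Finset.mul_sum]
    refine Finset.sum_congr rfl fun x' _ => ?_
    rw [Finset.mul_sum]
    refine Finset.sum_congr rfl fun z _ => ?_
    by_cases h : φA z = i
    · simp [hM, h, mul_comm]
    · simp [hM, h]
  set A := law J (fun ω => (C ω, ω.2.2, M ω)) with hA
  have hA0 : ∀ t, 0 ≤ A t := law_nonneg hJ0 _
  have hA1 : ∑ t, A t = 1 := (sum_law _ _).trans hJ1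
  have hAle : ∀ c x i, A (c, x, i) ≤ q x * pM i := by
    intro c x i
    rw [← hXM]
    have := sum_law_pair_left J C (fun ω => (ω.2.2, M ω)) (x, i)
    rw [← this]
    exact Finset.single_le_sum (f := fun a => law J (fun ω => (C ω, (ω.2.2, M ω))) (a, (x, i)))
      (fun a _ => law_nonneg hJ0 _ _) (Finset.mem_univ c)
  set Qx : (Fin m → 𝒳) × (Fin n → 𝒳) × Fin k → ℝ :=
    fun t => ∑ x, if S.Φ x t.2.1 = t.1 then Q t.2.2 x else 0 with hQx
  set B : (Fin m → 𝒳) × (Fin n → 𝒳) × Fin k → ℝ := fun t => q t.2.1 * pM t.2.2 * Qx t with hB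
  have hB0 : ∀ t, 0 ≤ B t := fun t => mul_nonneg (mul_nonneg (hq.1 _) (hpM0 _))
    (Finset.sum_nonneg fun x _ => by split_ifs <;> simp [(hQ _ _).le])
  have hB1 : ∑ t, B t ≤ 1 := by
    calc ∑ t, B t = ∑ x, ∑ i, q x * pM i * ∑ c, Qx (c, x, i) := by
          rw [Fintype.sum_prod_type, Finset.sum_comm, Fintype.sum_prod_type]
          simp [hB, Finset.mul_sum]
      _ ≤ ∑ x, ∑ i, q x * pM i * 1 := by
          refine Finset.sum_le_sum fun x _ => Finset.sum_le_sum fun i _ =>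
            mul_le_mul_of_nonneg_left ?_ (mul_nonneg (hq.1 _) (hpM0 _))
          refine le_trans (le_of_eq ?_) (hQ1 i)
          simp only [hQx]
          rw [Finset.sum_comm]
          simp
      _ = 1 := by
          simp only [mul_one, ← Finset.mul_sum]
          rw [hpM, sum_law, hJ1]
          simp [hq.2]
  have hterm : ∀ c x i, A (c, x, i) * Real.log N + (A (c, x, i) - B (c, x, i)) +
      A (c, x, i) * Real.log (Qx (c, x, i)) ≤
      A (c, x, i) * Real.log (A (c, x, i) * pM i / (pM i / N * (q x * pM i))) := by
    intro c x i
    rcases (hA0 (c, x, i)).eq_or_lt with h | h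
    · rw [← h]
      simpa using hB0 (c, x, i)
    · have hqp := h.trans_le (hAle c x i)
      have hpi : 0 < pM i := pos_of_mul_pos_right hqp (hq.1 x)
      have hqx : 0 < q x := pos_of_mul_pos_left hqp (hpM0 i)
      have hQpos : 0 < Qx (c, x, i) := by
        -- a cryptogram of positive probability is produced by some key
        by_contra hcon
        have hz : ∀ x', S.Φ x' x ≠ c := by
          intro x' hx'
          refine hcon (lt_of_lt_of_le (hQ i x') ?_)
          have := Finset.single_le_sum (f := fun y => if S.Φ y x = c then Q i y else 0)
            (fun y _ => by split_ifs <;> simp [(hQ _ _).le]) (Finset.mem_univ x')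
          simpa [hx'] using this
        refine h.ne' (Finset.sum_eq_zero fun ω _ => if_neg ?_)
        simp only [hC, Prod.mk.injEq]
        rintro ⟨h1, h2, -⟩
        rw [h2] at h1
        exact hz _ h1
      have hBpos : 0 < B (c, x, i) := mul_pos hqp hQpos
      have hG := sub_le_mul_log_div h hBpos
      have hsplit : A (c, x, i) * pM i / (pM i / N * (q x * pM i)) =
          N * (A (c, x, i) / B (c, x, i)) * Qx (c, x, i) := by
        simp only [hB]
        field_simp
      rw [hsplit, Real.log_mul (by positivity) hQpos.ne', Real.log_mul (by positivity)
        (by positivity)]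
      linarith
  have hleak : leakage pKZ S.Φ φA q = ∑ t : (Fin m → 𝒳) × (Fin n → 𝒳) × Fin k,
      A t * Real.log (A t * pM t.2.2 / (pM t.2.2 / N * (q t.2.1 * pM t.2.2))) := by
    simp only [Fintype.sum_prod_type]
    simp only [leakage, condMutualInfo]
    refine Finset.sum_congr rfl fun c _ => Finset.sum_congr rfl fun x _ =>
      Finset.sum_congr rfl fun i _ => ?_
    rw [← hCM c i, ← hXM x i]
  have hlogN : Real.log N = m * Real.log (Fintype.card 𝒳) := by rw [hN, Real.log_pow]
  have hcross : ∑ x, ∑ z, keyLaw pKZ n x z * Real.log (Q (φA z) x) ≤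
      ∑ t, A t * Real.log (Qx t) := by
    rw [hA, sum_law_mul]
    have h1 := sum_jointLaw_mul pKZ n q fun x z _ => Real.log (Q (φA z) x)
    simp only [← Finset.sum_mul, hq.2, one_mul] at h1
    rw [← h1]
    refine Finset.sum_le_sum fun ω _ => mul_le_mul_of_nonneg_left ?_ (hJ0 ω)
    refine Real.log_le_log (hQ _ _) ?_
    have := Finset.single_le_sum
      (f := fun y => if S.Φ y ω.2.2 = S.Φ ω.1 ω.2.2 then Q (φA ω.2.1) y else 0)
      (fun y _ => by split_ifs <;> simp [(hQ _ _).le]) (Finset.mem_univ ω.1)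
    simpa using this
  rw [hleak]
  have hsum := Finset.sum_le_sum fun (t : (Fin m → 𝒳) × (Fin n → 𝒳) × Fin k)
    (_ : t ∈ Finset.univ) => hterm t.1 t.2.1 t.2.2
  simp only [Finset.sum_add_distrib, Finset.sum_sub_distrib, ← Finset.sum_mul, Prod.mk.eta,
    hA1] at hsum
  linarith

end Leakage

/-! ### Tail bounds and random covering -/

section Covering

/-- Chernoff's bound, without an explicit exponent: the arithmetic mean of independent copies of
`f` exceeds a level above the expectation with exponentially small probability. -/
theorem exists_tail_le_pow {Ω : Type*} [Fintype Ω] {p : Ω → ℝ} (hp : p ∈ stdSimplex ℝ Ω)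
    (f : Ω → ℝ) {τ : ℝ} (hτ : ∑ ω, p ω * f ω < τ) :
    ∃ ρ : ℝ, 0 ≤ ρ ∧ ρ < 1 ∧ ∀ n : ℕ,
      ∑ ω : Fin n → Ω, (if n * τ ≤ ∑ t, f (ω t) then ∏ t, p (ω t) else 0) ≤ ρ ^ n := by
  classical
  set D : ℝ := τ - ∑ ω, p ω * f ω with hD
  have hDpos : 0 < D := sub_pos.2 hτ
  obtain ⟨B, hB1, hB⟩ : ∃ B : ℝ, 1 ≤ B ∧ ∀ ω, |f ω - τ| ≤ B := by
    refine ⟨1 + ∑ ω, |f ω - τ|, by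
      linarith [Finset.sum_nonneg fun ω (_ : ω ∈ Finset.univ) => abs_nonneg (f ω - τ)],
      fun ω => ?_⟩
    have := Finset.single_le_sum (f := fun ω => |f ω - τ|) (fun ω _ => abs_nonneg _)
      (Finset.mem_univ ω)
    linarith
  -- the exponent is chosen so that the linear term `-s D` beats the quadratic term `(s B) ^ 2`
  set s : ℝ := min (1 / B) (D / (2 * B ^ 2)) with hs
  have hB0 : 0 < B := by linarith
  have hspos : 0 < s := lt_min (by positivity) (by positivity)
  have hsB : s * B ≤ 1 := by
    have := mul_le_mul_of_nonneg_right (min_le_left (1 / B) (D / (2 * B ^ 2))) hB0.le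
    rwa [← hs, one_div_mul_cancel hB0.ne'] at this
  have hsB2 : s * B ^ 2 ≤ D / 2 := by
    have := mul_le_mul_of_nonneg_right (min_le_right (1 / B) (D / (2 * B ^ 2)))
      (by positivity : 0 ≤ B ^ 2)
    rw [← hs] at this
    refine this.trans (le_of_eq ?_)
    field_simp
  set g : Ω → ℝ := fun ω => p ω * Real.exp (s * (f ω - τ)) with hg
  have hg0 : ∀ ω, 0 ≤ g ω := fun ω => mul_nonneg (hp.1 ω) (Real.exp_pos _).le
  refine ⟨∑ ω, g ω, Finset.sum_nonneg fun ω _ => hg0 ω, ?_, fun n => ?_⟩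
  · have hle : ∀ ω, g ω ≤ p ω * (1 + s * (f ω - τ) + s ^ 2 * B ^ 2) := by
      intro ω
      refine mul_le_mul_of_nonneg_left ?_ (hp.1 ω)
      have habs : |s * (f ω - τ)| ≤ s * B := by
        rw [abs_mul, abs_of_pos hspos]
        exact mul_le_mul_of_nonneg_left (hB ω) hspos.le
      have h1 := Real.abs_exp_sub_one_sub_id_le (habs.trans hsB)
      have h2 : (s * (f ω - τ)) ^ 2 ≤ (s * B) ^ 2 := by
        rw [← sq_abs]
        exact pow_le_pow_left₀ (abs_nonneg _) habs 2
      have h3 := (abs_le.1 h1).2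
      nlinarith
    have hsum := Finset.sum_le_sum fun ω (_ : ω ∈ Finset.univ) => hle ω
    have heq : ∑ ω, p ω * (1 + s * (f ω - τ) + s ^ 2 * B ^ 2) = 1 - s * D + s ^ 2 * B ^ 2 := by
      have : ∀ ω, p ω * (1 + s * (f ω - τ) + s ^ 2 * B ^ 2) =
          (1 - s * τ + s ^ 2 * B ^ 2) * p ω + s * (p ω * f ω) := fun ω => by ring
      simp only [this, Finset.sum_add_distrib, ← Finset.mul_sum, hp.2]
      rw [hD]
      ring
    have : s * (s * B ^ 2) ≤ s * (D / 2) := mul_le_mul_of_nonneg_left hsB2 hspos.le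
    nlinarith [mul_pos hspos hDpos]
  · rw [Fintype.sum_pow]
    refine Finset.sum_le_sum fun ω _ => ?_
    split_ifs with h
    · simp only [hg, Finset.prod_mul_distrib, ← Real.exp_sum, ← Finset.mul_sum,
        Finset.sum_sub_distrib]
      refine le_mul_of_one_le_right (Finset.prod_nonneg fun _ _ => hp.1 _) ?_
      refine Real.one_le_exp (mul_nonneg hspos.le ?_)
      simpa using h
    · exact Finset.prod_nonneg fun _ _ => hg0 _

open Classical in
/-- Random covering. If a pair `(a, b)` counts as good only when its joint probability exceeds
the product of the marginals by a factor of at most `exp s`, then some codebook of size `M` leaves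
uncovered only slightly more than the bad pairs, as soon as `M` is large compared to `exp s`. -/
theorem exists_codebook {α β : Type*} [Fintype α] [Fintype β] {P : α → β → ℝ} {μ : α → ℝ}
    {ν : β → ℝ} (hP : ∀ a b, 0 ≤ P a b) (hμ : ∀ a, ∑ b, P a b = μ a)
    (hμ1 : ∑ a, μ a = 1) (hν : ν ∈ stdSimplex ℝ β) (G : α → β → Prop) (s : ℝ)
    (hG : ∀ a b, G a b → P a b ≤ Real.exp s * (μ a * ν b)) (M : ℕ) :
    ∃ c : Fin M → β, ∑ a, (if ∀ i, ¬ G a (c i) then μ a else 0) ≤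
      ∑ a, ∑ b, (if G a b then 0 else P a b) + Real.exp (-(M * Real.exp (-s))) := by
  have hμ0 : ∀ a, 0 ≤ μ a := fun a => hμ a ▸ Finset.sum_nonneg fun b _ => hP a b
  set T : ℝ := ∑ a, ∑ b, (if G a b then 0 else P a b) + Real.exp (-(M * Real.exp (-s))) with hT
  set F : (Fin M → β) → ℝ := fun c => ∑ a, (if ∀ i, ¬ G a (c i) then μ a else 0) with hF
  -- the average over codebooks with independent entries of law `ν`
  have havg : ∑ c : Fin M → β, (∏ i, ν (c i)) * F c =
      ∑ a, μ a * (∑ b, if G a b then 0 else ν b) ^ M := by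
    simp only [hF, Finset.mul_sum]
    rw [Finset.sum_comm]
    refine Finset.sum_congr rfl fun a _ => ?_
    rw [Fintype.sum_pow, Finset.mul_sum]
    refine Finset.sum_congr rfl fun c _ => ?_
    split_ifs with h
    · rw [mul_comm]
      congr 1
      exact Finset.prod_congr rfl fun i _ => by rw [if_neg (h i)]
    · push Not at h
      obtain ⟨i, hi⟩ := h
      have hz : (∏ j, if G a (c j) then 0 else ν (c j)) = 0 :=
        Finset.prod_eq_zero (Finset.mem_univ i) (if_pos hi)
      rw [hz]
      simp
  have hbound : ∀ a, μ a * (∑ b, if G a b then 0 else ν b) ^ M ≤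
      ∑ b, (if G a b then 0 else P a b) + μ a * Real.exp (-(M * Real.exp (-s))) := by
    intro a
    rcases (hμ0 a).eq_or_lt with h0 | h0
    · rw [← h0]
      simpa using Finset.sum_nonneg fun b (_ : b ∈ Finset.univ) => by
        split_ifs <;> simp [hP a b]
    set x : ℝ := ∑ b, if G a b then ν b else 0 with hx
    set y : ℝ := ∑ b, if G a b then P a b else 0 with hy
    have h1 : (∑ b, if G a b then 0 else ν b) = 1 - x := by
      rw [eq_sub_iff_add_eq, hx, ← Finset.sum_add_distrib, ← hν.2]
      exact Finset.sum_congr rfl fun b _ => by split_ifs <;> simp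
    have h2 : (∑ b, if G a b then 0 else P a b) = μ a - y := by
      rw [eq_sub_iff_add_eq, hy, ← Finset.sum_add_distrib, ← hμ a]
      exact Finset.sum_congr rfl fun b _ => by split_ifs <;> simp
    have hx1 : 0 ≤ 1 - x := h1 ▸ Finset.sum_nonneg fun b _ => by split_ifs <;> simp [hν.1 b]
    have hy0 : 0 ≤ y := Finset.sum_nonneg fun b _ => by split_ifs <;> simp [hP a b]
    have hy1 : 0 ≤ μ a - y := h2 ▸ Finset.sum_nonneg fun b _ => by split_ifs <;> simp [hP a b]
    have hyx : y ≤ Real.exp s * μ a * x := by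
      rw [hx, hy, Finset.mul_sum]
      refine Finset.sum_le_sum fun b _ => ?_
      split_ifs with h
      · simpa [mul_assoc] using hG a b h
      · simp
    rw [h1, h2]
    set r : ℝ := y / μ a with hr
    have hry : y = μ a * r := by rw [hr]; field_simp
    have hr0 : 0 ≤ r := div_nonneg hy0 h0.le
    have hr1 : r ≤ 1 := by rw [hr, div_le_one h0]; linarith
    have hrx : Real.exp (-s) * r ≤ x := by
      rw [hry] at hyx
      have h3 : r ≤ Real.exp s * x := by
        refine le_of_mul_le_mul_left ?_ h0
        linarith
      calc Real.exp (-s) * r ≤ Real.exp (-s) * (Real.exp s * x) :=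
            mul_le_mul_of_nonneg_left h3 (Real.exp_pos _).le
        _ = x := by rw [← mul_assoc, ← Real.exp_add]; simp
    set L : ℝ := M * Real.exp (-s) with hL
    have h4 : (1 - x) ^ M ≤ Real.exp (-(L * r)) := by
      calc (1 - x) ^ M ≤ Real.exp (-x) ^ M :=
            pow_le_pow_left₀ hx1 (Real.one_sub_le_exp_neg x) M
        _ = Real.exp (-(M * x)) := by rw [← Real.exp_nat_mul]; ring_nf
        _ ≤ Real.exp (-(L * r)) := by
            refine Real.exp_le_exp.2 (neg_le_neg ?_)
            rw [hL, mul_assoc]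
            exact mul_le_mul_of_nonneg_left hrx (Nat.cast_nonneg M)
    -- convexity of the exponential on the segment from `0` to `-L`
    have h5 : Real.exp (-(L * r)) ≤ (1 - r) + r * Real.exp (-L) := by
      have := convexOn_exp.2 (mem_univ (0 : ℝ)) (mem_univ (-L)) (sub_nonneg.2 hr1) hr0 (by ring)
      simp only [smul_eq_mul, Real.exp_zero, mul_zero, zero_add, mul_one] at this
      rwa [show r * -L = -(L * r) by ring] at this
    have h6 : r * Real.exp (-L) ≤ Real.exp (-L) :=
      mul_le_of_le_one_left (Real.exp_pos _).le hr1
    have := mul_le_mul_of_nonneg_left (h4.trans (h5.trans (add_le_add_right h6 (1 - r)))) h0.le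
    rw [hry]
    linarith
  have hle : ∑ c : Fin M → β, (∏ i, ν (c i)) * F c ≤ T := by
    rw [havg]
    refine (Finset.sum_le_sum fun a _ => hbound a).trans (le_of_eq ?_)
    rw [Finset.sum_add_distrib, ← Finset.sum_mul, hμ1, one_mul]
  by_contra hcon
  push Not at hcon
  have hone : ∑ c : Fin M → β, ∏ i, ν (c i) = 1 := by
    rw [← Fintype.sum_pow, hν.2, one_pow]
  have hw : ∀ c : Fin M → β, 0 ≤ ∏ i, ν (c i) := fun c => Finset.prod_nonneg fun i _ => hν.1 _
  obtain ⟨c₀, -, hc₀⟩ : ∃ c ∈ (Finset.univ : Finset (Fin M → β)), 0 < ∏ i, ν (c i) :=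
    Finset.exists_lt_of_sum_lt (f := fun _ => (0 : ℝ)) (by simp [hone])
  have : ∑ c : Fin M → β, (∏ i, ν (c i)) * T < ∑ c : Fin M → β, (∏ i, ν (c i)) * F c :=
    Finset.sum_lt_sum (fun c _ => mul_le_mul_of_nonneg_left (hcon c).le (hw c))
      ⟨c₀, Finset.mem_univ _, mul_lt_mul_of_pos_left (hcon c₀) hc₀⟩
  rw [← Finset.sum_mul, hone, one_mul] at this
  exact absurd hle (not_le.2 this)

/-- An additive function of independent coordinates has additive expectation; stated for
subprobability weights, so that no weight needs to be normalized. -/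
theorem sum_prod_mul_sum_le {κ : Type*} [Fintype κ] {n : ℕ} {w : Fin n → κ → ℝ}
    {f : Fin n → κ → ℝ} (hw : ∀ t k, 0 ≤ w t k) (hw1 : ∀ t, ∑ k, w t k ≤ 1)
    (hf : ∀ t k, 0 ≤ f t k) :
    ∑ k : Fin n → κ, (∏ t, w t (k t)) * ∑ t, f t (k t) ≤ ∑ t, ∑ k, w t k * f t k := by
  classical
  simp only [Finset.mul_sum]
  rw [Finset.sum_comm]
  refine Finset.sum_le_sum fun t _ => ?_
  have h : ∀ k : Fin n → κ, (∏ s, w s (k s)) * f t (k t) =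
      ∏ s, w s (k s) * (if s = t then f s (k s) else 1) := by
    intro k
    rw [Finset.prod_mul_distrib]
    simp
  simp only [h]
  rw [← Fintype.prod_sum fun s k => w s k * (if s = t then f s k else 1),
    ← Finset.mul_prod_erase _ _ (Finset.mem_univ t)]
  simp only [if_true]
  refine mul_le_of_le_one_right
    (Finset.sum_nonneg fun k _ => mul_nonneg (hw t k) (hf t k)) ?_
  refine Finset.prod_le_one (fun s _ => Finset.sum_nonneg fun k _ => ?_) fun s hs => ?_
  · rw [if_neg ?_, mul_one]
    · exact hw s k
    · exact (Finset.mem_erase.1 ‹_›).1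
  · simpa [(Finset.mem_erase.1 hs).1] using hw1 s

end Covering

/-! ### The helper's encoder -/

section Helper

open Filter Topology

/-- Achievability in rate-distortion theory: if `(Z, U)` has law `P` and the rate exceeds
`I(Z ; U)`, then for large block length the words of `Z` can be represented by codewords over the
alphabet of `U` with expected average distortion below any level above `E d(Z, U)`. -/
theorem eventually_exists_rateDistortion_code {α β : Type*} [Fintype α] [Fintype β]
    {P : α × β → ℝ} (hP : P ∈ stdSimplex ℝ (α × β)) {μ : α → ℝ} {ν : β → ℝ}
    (hμ : ∀ a, ∑ b, P (a, b) = μ a) (hν : ∀ b, ∑ a, P (a, b) = ν b) (d : α × β → ℝ) {r D : ℝ}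
    (hr0 : 0 < r) (hr : ∑ i, P i * Real.log (P i / (μ i.1 * ν i.2)) < r)
    (hD : ∑ i, P i * d i < D) :
    ∀ᶠ n : ℕ in atTop, ∃ M : ℕ, (M : ℝ) ≤ Real.exp (n * r) ∧
      ∃ (φ : (Fin n → α) → Fin M) (c : Fin M → Fin n → β),
        ∑ a : Fin n → α, (∏ t, μ (a t)) * ∑ t, d (a t, c (φ a) t) ≤ n * D := by
  classical
  have hμ0 : ∀ a, 0 ≤ μ a := fun a => hμ a ▸ Finset.sum_nonneg fun b _ => hP.1 _
  have hν0 : ∀ b, 0 ≤ ν b := fun b => hν b ▸ Finset.sum_nonneg fun a _ => hP.1 _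
  have hμ1 : ∑ a, μ a = 1 := by simp only [← hμ, ← Fintype.sum_prod_type, hP.2]
  have hν1 : ∑ b, ν b = 1 := by simp only [← hν, ← Fintype.sum_prod_type_right, hP.2]
  set ι : α × β → ℝ := fun i => Real.log (P i / (μ i.1 * ν i.2)) with hι
  obtain ⟨r', hr1, hr2⟩ := exists_between (max_lt hr hr0)
  rw [max_lt_iff] at hr1
  obtain ⟨hr1, hr'0⟩ := hr1
  obtain ⟨D', hD1, hD2⟩ := exists_between hD
  obtain ⟨ρ₁, hρ₁0, hρ₁1, htail₁⟩ := exists_tail_le_pow hP ι hr1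
  obtain ⟨ρ₂, hρ₂0, hρ₂1, htail₂⟩ := exists_tail_le_pow hP d hD1
  set B : ℝ := ∑ i, |d i - D'| with hB
  have hB0 : 0 ≤ B := Finset.sum_nonneg fun _ _ => abs_nonneg _
  have hdB : ∀ i, d i ≤ D' + B := fun i => by
    have := Finset.single_le_sum (f := fun i => |d i - D'|) (fun _ _ => abs_nonneg _)
      (Finset.mem_univ i)
    linarith [le_abs_self (d i - D')]
  have hsmall : ∀ᶠ n : ℕ in atTop,
      B * (ρ₁ ^ n + ρ₂ ^ n + Real.exp (-(Real.exp (n * (r - r')) - 1))) ≤ D - D' := by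
    have h1 := tendsto_pow_atTop_nhds_zero_of_lt_one hρ₁0 hρ₁1
    have h2 := tendsto_pow_atTop_nhds_zero_of_lt_one hρ₂0 hρ₂1
    have h3 : Tendsto (fun n : ℕ => Real.exp (-(Real.exp (n * (r - r')) - 1))) atTop (𝓝 0) := by
      refine Real.tendsto_exp_atBot.comp (tendsto_neg_atTop_atBot.comp ?_)
      refine tendsto_atTop_add_const_right _ (-1) (Real.tendsto_exp_atTop.comp ?_)
      exact tendsto_natCast_atTop_atTop.atTop_mul_const (sub_pos.2 hr2)
    have h4 := ((h1.add h2).add h3).const_mul B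
    simp only [add_zero, mul_zero] at h4
    exact h4.eventually_le_const (sub_pos.2 hD2)
  filter_upwards [hsmall] with n hn
  set M : ℕ := ⌊Real.exp (n * r)⌋₊ with hM
  have hMpos : 0 < M := Nat.floor_pos.2 (Real.one_le_exp (by positivity))
  refine ⟨M, Nat.floor_le (Real.exp_pos _).le, ?_⟩
  set G : (Fin n → α) → (Fin n → β) → Prop :=
    fun a b => ∑ t, ι (a t, b t) < n * r' ∧ ∑ t, d (a t, b t) < n * D' with hGdef
  have hι' : ∀ i, P i ≤ Real.exp (ι i) * (μ i.1 * ν i.2) := by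
    intro i
    rcases (hP.1 i).eq_or_lt with h | h
    · rw [← h]
      exact mul_nonneg (Real.exp_pos _).le (mul_nonneg (hμ0 _) (hν0 _))
    · have h1 : P i ≤ μ i.1 := hμ i.1 ▸ Finset.single_le_sum
        (f := fun b => P (i.1, b)) (fun b _ => hP.1 _) (Finset.mem_univ i.2)
      have h2 : P i ≤ ν i.2 := hν i.2 ▸ Finset.single_le_sum
        (f := fun a => P (a, i.2)) (fun a _ => hP.1 _) (Finset.mem_univ i.1)
      have h3 : 0 < μ i.1 * ν i.2 := mul_pos (h.trans_le h1) (h.trans_le h2)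
      rw [hι, Real.exp_log (div_pos h h3), div_mul_cancel₀ _ h3.ne']
  obtain ⟨c, hc⟩ := exists_codebook (P := fun (a : Fin n → α) (b : Fin n → β) => ∏ t, P (a t, b t))
    (μ := fun a => ∏ t, μ (a t)) (ν := fun b => ∏ t, ν (b t))
    (fun a b => Finset.prod_nonneg fun t _ => hP.1 _)
    (fun a => by
      simp only [← hμ]
      rw [Fintype.prod_sum])
    (by rw [← Fintype.sum_pow, hμ1, one_pow])
    ⟨fun b => Finset.prod_nonneg fun t _ => hν0 _, by rw [← Fintype.sum_pow, hν1, one_pow]⟩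
    G (n * r') (fun a b hab => by
      calc ∏ t, P (a t, b t) ≤ ∏ t, Real.exp (ι (a t, b t)) * (μ (a t) * ν (b t)) :=
            Finset.prod_le_prod (fun t _ => hP.1 _) fun t _ => hι' _
        _ = Real.exp (∑ t, ι (a t, b t)) * ((∏ t, μ (a t)) * ∏ t, ν (b t)) := by
            rw [Finset.prod_mul_distrib, Finset.prod_mul_distrib, Real.exp_sum]
        _ ≤ _ := mul_le_mul_of_nonneg_right (Real.exp_le_exp.2 hab.1.le)
            (mul_nonneg (Finset.prod_nonneg fun t _ => hμ0 _)
              (Finset.prod_nonneg fun t _ => hν0 _))) M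
  have hbad : ∑ a : Fin n → α, ∑ b : Fin n → β, (if G a b then 0 else ∏ t, P (a t, b t)) ≤
      ρ₁ ^ n + ρ₂ ^ n := by
    refine le_trans ?_ (add_le_add (htail₁ n) (htail₂ n))
    rw [← Finset.sum_add_distrib,
      ← (Equiv.arrowProdEquivProdArrow (Fin n) (fun _ => α) (fun _ => β)).symm.sum_comp,
      Fintype.sum_prod_type]
    refine Finset.sum_le_sum fun a _ => Finset.sum_le_sum fun b _ => ?_
    have h0 : 0 ≤ ∏ t, P (a t, b t) := Finset.prod_nonneg fun t _ => hP.1 _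
    change _ ≤ (if n * r' ≤ ∑ t, ι (a t, b t) then ∏ t, P (a t, b t) else 0) +
      (if n * D' ≤ ∑ t, d (a t, b t) then ∏ t, P (a t, b t) else 0)
    by_cases hG : G a b
    · rw [if_pos hG]
      split_ifs <;> linarith
    · rw [if_neg hG]
      simp only [hGdef, not_and_or, not_lt] at hG
      rcases hG with h | h
      · rw [if_pos h]
        split_ifs <;> linarith
      · rw [if_pos h]
        split_ifs <;> linarith
  have hMexp : Real.exp (-(M * Real.exp (-(n * r')))) ≤
      Real.exp (-(Real.exp (n * (r - r')) - 1)) := by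
    refine Real.exp_le_exp.2 (neg_le_neg ?_)
    have h1 : Real.exp (n * r) - 1 ≤ M := (Nat.sub_one_lt_floor _).le
    have h2 := mul_le_mul_of_nonneg_right h1 (Real.exp_pos (-(n * r'))).le
    have h3 : Real.exp (n * r) * Real.exp (-(n * r')) = Real.exp (n * (r - r')) := by
      rw [← Real.exp_add]
      ring_nf
    have h4 : Real.exp (-(n * r')) ≤ 1 := Real.exp_le_one_iff.2 (by
      have : 0 ≤ n * r' := by positivity
      linarith)
    linarith
  set φ : (Fin n → α) → Fin M :=
    fun a => if h : ∃ i, G a (c i) then h.choose else ⟨0, hMpos⟩ with hφ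
  refine ⟨φ, c, ?_⟩
  have hword : ∀ a : Fin n → α, ∑ t, d (a t, c (φ a) t) ≤
      n * D' + n * B * (if ∀ i, ¬ G a (c i) then 1 else 0) := by
    intro a
    split_ifs with h
    · calc ∑ t, d (a t, c (φ a) t) ≤ ∑ _t : Fin n, (D' + B) := Finset.sum_le_sum fun t _ => hdB _
        _ = _ := by simp
    · push Not at h
      have : G a (c (φ a)) := by
        simp only [hφ, dif_pos h]
        exact h.choose_spec
      linarith [this.2]
  calc ∑ a : Fin n → α, (∏ t, μ (a t)) * ∑ t, d (a t, c (φ a) t)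
      ≤ ∑ a : Fin n → α, (∏ t, μ (a t)) *
          (n * D' + n * B * (if ∀ i, ¬ G a (c i) then 1 else 0)) :=
        Finset.sum_le_sum fun a _ =>
          mul_le_mul_of_nonneg_left (hword a) (Finset.prod_nonneg fun t _ => hμ0 _)
    _ = n * D' + n * (B * ∑ a : Fin n → α, (if ∀ i, ¬ G a (c i) then ∏ t, μ (a t) else 0)) := by
        have h1 : ∑ a : Fin n → α, ∏ t, μ (a t) = 1 := by rw [← Fintype.sum_pow, hμ1, one_pow]
        simp only [mul_add, Finset.sum_add_distrib, ← Finset.sum_mul, h1, one_mul,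
          Finset.mul_sum]
        congr 1
        refine Finset.sum_congr rfl fun a _ => ?_
        split_ifs <;> ring
    _ ≤ n * D' + n * (D - D') := by
        refine add_le_add_right (mul_le_mul_of_nonneg_left ?_ (Nat.cast_nonneg n)) _
        refine le_trans (mul_le_mul_of_nonneg_left ?_ hB0) hn
        refine (le_of_eq ?_).trans (hc.trans (add_le_add (le_of_eq_of_le ?_ hbad) hMexp)) <;>
          congr!
    _ = n * D := by ring

/-- Conditional entropy is approached by cross-entropies relative to positive kernels. Mixing the
conditional law with a little of the uniform law makes the logarithm finite everywhere. -/
theorem exists_kernel_crossEntropy_lt {Ω α β : Type*} [Fintype Ω] [Fintype α] [Fintype β]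
    [Nonempty α] {p : Ω → ℝ} (hp : p ∈ stdSimplex ℝ Ω) (A : Ω → α) (B : Ω → β) {R : ℝ}
    (hR : condEntropy p A B < R) :
    ∃ Q : β → α → ℝ, (∀ b a, 0 < Q b a) ∧ (∀ b, ∑ a, Q b a ≤ 1) ∧
      ∑ ω, p ω * -Real.log (Q (B ω) (A ω)) < R := by
  set ν : β → ℝ := law p B with hν
  set κ : α × β → ℝ := law p (fun ω => (A ω, B ω)) with hκ
  have hν0 : ∀ b, 0 ≤ ν b := law_nonneg hp.1 _
  have hκ0 : ∀ i, 0 ≤ κ i := law_nonneg hp.1 _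
  have hκν : ∀ b, ∑ a, κ (a, b) = ν b := sum_law_pair_left p A B
  obtain ⟨η, hη0, hη⟩ : ∃ η : ℝ, 0 < η ∧ condEntropy p A B + η < R :=
    ⟨(R - condEntropy p A B) / 2, by linarith, by linarith⟩
  set l : ℝ := 1 - Real.exp (-η) with hl
  have hl0 : 0 < l := sub_pos.2 (Real.exp_lt_one_iff.2 (by linarith))
  have hcard : (0 : ℝ) < Fintype.card α := by exact_mod_cast Fintype.card_pos
  set Q : β → α → ℝ :=
    fun b a => Real.exp (-η) * (κ (a, b) / ν b) + l / Fintype.card α with hQ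
  have hQ0 : ∀ b a, 0 < Q b a := fun b a => add_pos_of_nonneg_of_pos
    (mul_nonneg (Real.exp_pos _).le (div_nonneg (hκ0 _) (hν0 _))) (div_pos hl0 hcard)
  refine ⟨Q, hQ0, fun b => ?_, ?_⟩
  · simp only [hQ, Finset.sum_add_distrib, ← Finset.mul_sum, ← Finset.sum_div, hκν]
    -- only `≤`, since `ν b / ν b = 0` when `ν b = 0`
    have h1 : ν b / ν b ≤ 1 := div_self_le_one _
    have h2 := mul_le_mul_of_nonneg_left h1 (Real.exp_pos (-η)).le
    have h3 : (∑ _a : α, l) / Fintype.card α = l := by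
      simp only [Finset.sum_const, Finset.card_univ, nsmul_eq_mul]
      field_simp
    rw [h3]
    linarith
  · refine lt_of_le_of_lt ?_ hη
    have h1 : ∑ i, κ i * -Real.log (Q i.2 i.1) = ∑ ω, p ω * -Real.log (Q (B ω) (A ω)) :=
      sum_law_mul p (fun ω => (A ω, B ω)) fun i : α × β => -Real.log (Q i.2 i.1)
    have h2 : ∑ i, κ i = 1 := (sum_law _ _).trans hp.2
    have h3 : condEntropy p A B + η =
        ∑ i : α × β, (κ i * η - κ i * Real.log (κ i / ν i.2)) := by
      rw [Finset.sum_sub_distrib, ← Finset.sum_mul, h2, Fintype.sum_prod_type]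
      simp only [condEntropy]
      ring
    rw [← h1, h3]
    refine Finset.sum_le_sum fun i _ => ?_
    rcases (hκ0 i).eq_or_lt with h | h
    · simp [← h]
    · have hκi : κ i ≤ ν i.2 := hκν i.2 ▸ Finset.single_le_sum (f := fun a => κ (a, i.2))
        (fun _ _ => hκ0 _) (Finset.mem_univ i.1)
      have hdiv : 0 < κ i / ν i.2 := div_pos h (h.trans_le hκi)
      rw [← mul_sub]
      refine mul_le_mul_of_nonneg_left ?_ h.le
      have h4 : Real.exp (-η) * (κ i / ν i.2) ≤ Q i.2 i.1 :=
        le_add_of_nonneg_right (div_pos hl0 hcard).le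
      have h5 := Real.log_le_log (mul_pos (Real.exp_pos _) hdiv) h4
      rw [Real.log_mul (Real.exp_pos _).ne' hdiv.ne', Real.log_exp] at h5
      linarith

theorem law_id {Ω : Type*} [Fintype Ω] (p : Ω → ℝ) : law p (fun ω => ω) = p := by
  funext a
  rw [law, Finset.sum_eq_single a (fun b _ hb => if_neg hb) (by simp), if_pos rfl]

variable {𝒳 𝒵 : Type*} [Fintype 𝒳] [Fintype 𝒵]

/-- The direct part of the one-helper problem, in terms of cross-entropy: an encoder of rate above
`I(Z ; U)` tells enough about the key that a kernel from messages to keys describes it with at most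
`R` nats per letter, for any `R` above `H(K | U)`. -/
theorem eventually_exists_helper_encoder [Nonempty 𝒳] {pKZ : 𝒳 × 𝒵 → ℝ} {a : ℕ}
    {p : Fin a × 𝒵 × 𝒳 → ℝ} (hp : p ∈ auxLaws pKZ a) {RA R : ℝ} (hRA0 : 0 < RA)
    (hRA : mutualInfo p (fun ω => ω.2.1) (fun ω => ω.1) < RA)
    (hR : condEntropy p (fun ω => ω.2.2) (fun ω => ω.1) < R) :
    ∀ᶠ n : ℕ in atTop, ∃ M : ℕ, (M : ℝ) ≤ Real.exp (n * RA) ∧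
      ∃ (φ : (Fin n → 𝒵) → Fin M) (Q : Fin M → (Fin n → 𝒳) → ℝ),
        (∀ i x, 0 < Q i x) ∧ (∀ i, ∑ x, Q i x ≤ 1) ∧
          -(n * R) ≤ ∑ x, ∑ z, keyLaw pKZ n x z * Real.log (Q (φ z) x) := by
  classical
  obtain ⟨-, hpS, hpKZ, hmarkov⟩ := hp
  set μ : 𝒵 → ℝ := law p (fun ω => ω.2.1) with hμ
  set P : 𝒵 × Fin a → ℝ := law p (fun ω => (ω.2.1, ω.1)) with hP
  have hμ0 : ∀ z, 0 ≤ μ z := law_nonneg hpS.1 _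
  have hpKZ0 : ∀ i, 0 ≤ pKZ i := hpKZ ▸ law_nonneg hpS.1 _
  have hμZ : ∀ z, ∑ x, pKZ (x, z) = μ z := fun z => by
    rw [← hpKZ]
    exact sum_law_pair_left p (fun ω => ω.2.2) (fun ω => ω.2.1) z
  set W : 𝒵 → 𝒳 → ℝ := fun z x => pKZ (x, z) / μ z with hW
  have hW0 : ∀ z x, 0 ≤ W z x := fun z x => div_nonneg (hpKZ0 _) (hμ0 _)
  have hW1 : ∀ z, ∑ x, W z x ≤ 1 := fun z => by
    simp only [hW, ← Finset.sum_div, hμZ]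
    exact div_self_le_one _
  have hle : ∀ x z, pKZ (x, z) ≤ μ z := fun x z => hμZ z ▸ Finset.single_le_sum
    (f := fun x => pKZ (x, z)) (fun _ _ => hpKZ0 _) (Finset.mem_univ x)
  have hμW : ∀ x z, μ z * W z x = pKZ (x, z) := fun x z => by
    rcases (hμ0 z).eq_or_lt with h | h
    · have := hle x z
      rw [← h] at this ⊢
      rw [zero_mul, le_antisymm this (hpKZ0 _)]
    · simp only [hW]
      field_simp
  obtain ⟨Q₁, hQ₁0, hQ₁1, hQ₁R⟩ := exists_kernel_crossEntropy_lt hpS _ _ hR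
  set f : Fin a → 𝒳 → ℝ := fun u x => -Real.log (Q₁ u x) with hf
  have hf0 : ∀ u x, 0 ≤ f u x := fun u x => neg_nonneg.2 (Real.log_nonpos (hQ₁0 u x).le
    ((Finset.single_le_sum (fun y _ => (hQ₁0 u y).le) (Finset.mem_univ x)).trans (hQ₁1 u)))
  set d : 𝒵 × Fin a → ℝ := fun i => ∑ x, W i.1 x * f i.2 x with hd
  have hPW : ∀ u z x, P (z, u) * W z x = p (u, z, x) := by
    intro u z x
    have h := hmarkov u z x
    have h1 : law p (fun ω => (ω.1, ω.2.1, ω.2.2)) (u, z, x) = p (u, z, x) :=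
      congrFun (law_id p) _
    have h2 : law p (fun ω => (ω.1, ω.2.1)) (u, z) = P (z, u) := by
      simp only [hP, law, Prod.mk.injEq, and_comm]
    have h3 : law p (fun ω => (ω.2.1, ω.2.2)) (z, x) = pKZ (x, z) := by
      rw [← hpKZ]
      simp only [law, Prod.mk.injEq, and_comm]
    rw [h1, h2, h3] at h
    rcases (hμ0 z).eq_or_lt with h0 | h0
    · have h4 : p (u, z, x) ≤ μ z := by
        have := Finset.single_le_sum (f := fun ω : Fin a × 𝒵 × 𝒳 => if ω.2.1 = z then p ω else 0)
          (fun ω _ => by split_ifs <;> simp [hpS.1 ω]) (Finset.mem_univ (u, z, x))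
        simpa [hμ, law] using this
      rw [← h0] at h4
      simp [hW, ← h0, le_antisymm h4 (hpS.1 _)]
    · simp only [hW]
      rw [← mul_div_assoc, ← h, mul_div_assoc, div_self h0.ne', mul_one]
  have hmean : ∑ i, P i * d i < R := by
    refine lt_of_eq_of_lt ?_ hQ₁R
    simp only [hd, Finset.mul_sum, Fintype.sum_prod_type, ← mul_assoc, hPW]
    rw [Finset.sum_comm]
  have hrate : ∑ i, P i * Real.log (P i / (μ i.1 * law p (fun ω => ω.1) i.2)) < RA := by
    rw [Fintype.sum_prod_type]
    exact hRA
  filter_upwards [eventually_exists_rateDistortion_code (law_mem_stdSimplex hpS _)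
    (fun z => sum_law_pair_right p _ _ z) (fun u => sum_law_pair_left p _ _ u) d hRA0 hrate hmean]
    with n hn
  obtain ⟨M, hM, φ, c, hc⟩ := hn
  refine ⟨M, hM, φ, fun i x => ∏ t, Q₁ (c i t) (x t),
    fun i x => Finset.prod_pos fun t _ => hQ₁0 _ _, fun i => ?_, ?_⟩
  · rw [← Fintype.prod_sum fun t x => Q₁ (c i t) x]
    exact Finset.prod_le_one (fun t _ => Finset.sum_nonneg fun x _ => (hQ₁0 _ _).le)
      fun t _ => hQ₁1 _
  · rw [neg_le, ← Finset.sum_neg_distrib]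
    refine le_trans ?_ hc
    simp only [← Finset.sum_neg_distrib]
    rw [Finset.sum_comm]
    refine Finset.sum_le_sum fun z _ => ?_
    have h1 : ∀ x : Fin n → 𝒳,
        -(keyLaw pKZ n x z * Real.log (∏ t, Q₁ (c (φ z) t) (x t))) =
          (∏ t, μ (z t)) * ((∏ t, W (z t) (x t)) * ∑ t, f (c (φ z) t) (x t)) := by
      intro x
      rw [Real.log_prod fun t _ => (hQ₁0 _ _).ne', ← mul_assoc, ← Finset.prod_mul_distrib]
      simp only [hμW, hf, Finset.sum_neg_distrib, keyLaw]
      ring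
    simp only [h1, ← Finset.mul_sum]
    exact mul_le_mul_of_nonneg_left
      (sum_prod_mul_sum_le (fun t x => hW0 (z t) x) (fun t => hW1 _) fun t x => hf0 (c (φ z) t) x)
      (Finset.prod_nonneg fun t _ => hμ0 _)

end Helper

/-! ### Codes of rate zero -/

section Source

open Filter Topology

variable {𝒳 : Type*} [Fintype 𝒳]

/-- Only words in the decoder's range are decoded correctly, and no word has probability more than
the `n`-th power of the largest letter probability. -/
theorem one_sub_le_errorProb {pX : 𝒳 → ℝ} (hpX : pX ∈ stdSimplex ℝ 𝒳) {b : ℝ}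
    (hb : ∀ x, pX x ≤ b) {n m : ℕ} (S : SourceCode 𝒳 n m) :
    1 - (Fintype.card 𝒳 : ℝ) ^ m * b ^ n ≤ errorProb S pX := by
  classical
  have hsum : ∑ x : Fin n → 𝒳, sourceLaw pX n x = 1 := by
    simp only [sourceLaw]
    rw [← Fintype.sum_pow, hpX.2, one_pow]
  have h0 : ∀ x : Fin n → 𝒳, 0 ≤ sourceLaw pX n x :=
    fun x => Finset.prod_nonneg fun t _ => hpX.1 _
  have hle : ∀ x : Fin n → 𝒳, sourceLaw pX n x ≤ b ^ n := fun x => by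
    simpa [sourceLaw] using Finset.prod_le_prod (s := Finset.univ)
      (fun t _ => hpX.1 (x t)) (fun t _ => hb (x t))
  have hcorrect : ∑ x : Fin n → 𝒳, (if S.ψ (S.φ x) ≠ x then 0 else sourceLaw pX n x) ≤
      (Fintype.card 𝒳 : ℝ) ^ m * b ^ n := by
    calc ∑ x : Fin n → 𝒳, (if S.ψ (S.φ x) ≠ x then 0 else sourceLaw pX n x)
        ≤ ∑ x : Fin n → 𝒳, ∑ c, (if S.ψ c = x then sourceLaw pX n x else 0) := by
          refine Finset.sum_le_sum fun x _ => ?_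
          have hnn : ∀ c ∈ Finset.univ, 0 ≤ (if S.ψ c = x then sourceLaw pX n x else 0) :=
            fun c _ => by split_ifs <;> simp [h0 x]
          split_ifs with h
          · exact Finset.sum_nonneg hnn
          · refine le_trans ?_ (Finset.single_le_sum hnn (Finset.mem_univ (S.φ x)))
            rw [if_pos (not_not.1 h)]
      _ = ∑ c, sourceLaw pX n (S.ψ c) := by
          rw [Finset.sum_comm]
          simp
      _ ≤ ∑ _c : Fin m → 𝒳, b ^ n := Finset.sum_le_sum fun c _ => hle _
      _ = _ := by simp
  have hsplit : errorProb S pX + ∑ x : Fin n → 𝒳, (if S.ψ (S.φ x) ≠ x then 0 else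
      sourceLaw pX n x) = 1 := by
    rw [errorProb, ← Finset.sum_add_distrib, ← hsum]
    refine Finset.sum_congr rfl fun x _ => ?_
    split_ifs <;> simp
  linarith

theorem exists_bound_lt_one {pX : 𝒳 → ℝ} (hpX : pX ∈ stdSimplex ℝ 𝒳) (hne : ∀ x, pX x ≠ 1) :
    ∃ b : ℝ, 0 < b ∧ b < 1 ∧ ∀ x, pX x ≤ b := by
  classical
  have : Nonempty 𝒳 := by
    by_contra h
    rw [not_nonempty_iff] at h
    simpa using hpX.2
  obtain ⟨x₀, hx₀⟩ := Finite.exists_max pX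
  have hle : ∀ x, pX x ≤ 1 := fun x => hpX.2 ▸ Finset.single_le_sum (f := pX)
    (fun y _ => hpX.1 y) (Finset.mem_univ x)
  refine ⟨pX x₀, ?_, lt_of_le_of_ne (hle x₀) (hne x₀), hx₀⟩
  by_contra h
  have h1 : ∑ x, pX x ≤ 0 := Finset.sum_nonpos fun x _ => (hx₀ x).trans (not_lt.1 h)
  linarith [hpX.2]

/-- A non-deterministic source cannot be compressed to rate zero with error probability bounded
away from one. -/
theorem Admissible.rate_ne_zero {𝒵 : Type*} [Fintype 𝒵] {ε δ : ℝ} {pX : 𝒳 → ℝ}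
    (hpX : pX ∈ stdSimplex ℝ 𝒳) (hne : ∀ x, pX x ≠ 1) (hδ : δ < 1) {pKZ : 𝒳 × 𝒵 → ℝ} {RA R : ℝ}
    (h : Admissible ε δ pX pKZ RA R) : R ≠ 0 := by
  rintro rfl
  obtain ⟨b, hb0, hb1, hb⟩ := exists_bound_lt_one hpX hne
  have hcard : (0 : ℝ) < Fintype.card 𝒳 := by
    have : Nonempty 𝒳 := by
      by_contra h
      rw [not_nonempty_iff] at h
      simpa using hpX.2
    exact_mod_cast Fintype.card_pos
  obtain ⟨m, S, hS⟩ := h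
  have hlog : Real.log b < 0 := Real.log_neg hb0 hb1
  -- at rate `γ` the probability of correct decoding is at most `(e ^ γ * b) ^ n = e ^ (-γ n)`
  set γ : ℝ := -Real.log b / 2 with hγ
  have hγ0 : 0 < γ := by linarith
  obtain ⟨n₀, hn₀⟩ := hS γ hγ0
  have hlim : Tendsto (fun n : ℕ => Real.exp (-(n * γ))) atTop (𝓝 0) :=
    Real.tendsto_exp_atBot.comp (tendsto_neg_atTop_atBot.comp
      (tendsto_natCast_atTop_atTop.atTop_mul_const hγ0))
  obtain ⟨n, hn, hn0, hnpos⟩ := ((hlim.eventually_lt_const (sub_pos.2 hδ)).and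
    ((eventually_ge_atTop n₀).and (eventually_gt_atTop 0))).exists
  obtain ⟨hrate, herr, -⟩ := hn₀ n hn0
  have hnR : (0 : ℝ) < n := by exact_mod_cast hnpos
  have h1 := one_sub_le_errorProb hpX hb (S n).base
  have h2 : (m n : ℝ) * Real.log (Fintype.card 𝒳) ≤ n * γ := by
    have := mul_le_mul_of_nonneg_left hrate.2 hnR.le
    have h3 : (n : ℝ) * ((m n : ℝ) / n * Real.log (Fintype.card 𝒳)) =
      m n * Real.log (Fintype.card 𝒳) := by field_simp
    rw [h3] at this
    linarith
  have h4 : (Fintype.card 𝒳 : ℝ) ^ m n * b ^ n ≤ Real.exp (-(n * γ)) := by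
    have h5 : (Fintype.card 𝒳 : ℝ) ^ m n * b ^ n =
        Real.exp (m n * Real.log (Fintype.card 𝒳) + n * Real.log b) := by
      rw [Real.exp_add, Real.exp_nat_mul, Real.exp_nat_mul, Real.exp_log hcard, Real.exp_log hb0]
    rw [h5]
    refine Real.exp_le_exp.2 ?_
    have : Real.log b = -2 * γ := by rw [hγ]; ring
    rw [this]
    linarith
  linarith

theorem Admissible.rate_nonneg {𝒵 : Type*} [Fintype 𝒵] {ε δ : ℝ} {pX : 𝒳 → ℝ}
    {pKZ : 𝒳 × 𝒵 → ℝ} {RA R : ℝ} (h : Admissible ε δ pX pKZ RA R) : 0 ≤ R := by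
  obtain ⟨m, S, hS⟩ := h
  refine le_of_forall_pos_le_add fun γ hγ => ?_
  obtain ⟨n₀, hn₀⟩ := hS γ hγ
  refine le_trans ?_ (hn₀ n₀ le_rfl).1.2
  exact mul_nonneg (by positivity) (Real.log_natCast_nonneg _)

end Source

/-! ### Admissible pairs are not interior to the one-helper region -/

section Converse

open Filter Topology

variable {𝒳 𝒵 : Type*} [Fintype 𝒳] [Fintype 𝒵]

/-- If the helper can describe the key at rate below `R_A` so that less than `R` nats per letter
of uncertainty remain, then an adversary running the helper's encoder makes the leakage grow
linearly in the block length. -/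
theorem Admissible.not_lt {ε δ : ℝ} {pX : 𝒳 → ℝ} {pKZ : 𝒳 × 𝒵 → ℝ}
    (hpKZ : pKZ ∈ stdSimplex ℝ (𝒳 × 𝒵)) {RA R : ℝ} (hRA : 0 < RA)
    (h : Admissible ε δ pX pKZ RA R) {RA' R' : ℝ} (hmem : (RA', R') ∈ akwRegion pKZ)
    (hRA' : RA' < RA) : R ≤ R' := by
  by_contra! hR'
  obtain ⟨-, a, p, hp, hI, hH⟩ := hmem
  have : Nonempty 𝒳 := by
    by_contra h
    rw [not_nonempty_iff] at h
    simpa using hpKZ.2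
  obtain ⟨m, S, hS⟩ := h
  set γ : ℝ := (R - R') / 3 with hγ
  have hγ0 : 0 < γ := by linarith
  obtain ⟨n₀, hn₀⟩ := hS γ hγ0
  have henc := eventually_exists_helper_encoder hp hRA (hI.trans_lt hRA')
    (hH.trans_lt (lt_add_of_pos_right R' hγ0))
  have hbig : ∀ᶠ n : ℕ in atTop, ε < n * γ :=
    (tendsto_natCast_atTop_atTop.atTop_mul_const hγ0).eventually_gt_atTop ε
  obtain ⟨n, ⟨M, hM, φ, Q, hQ0, hQ1, hQ⟩, hn, hn0, hnpos⟩ := (henc.and (hbig.and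
    ((eventually_ge_atTop n₀).and (eventually_gt_atTop 0)))).exists
  obtain ⟨hrate, -, hleak⟩ := hn₀ n hn0
  have hnR : (0 : ℝ) < n := by exact_mod_cast hnpos
  set q := law (uniformLaw 𝒳 (m n)) (S n).base.ψ with hq
  have hqS : q ∈ stdSimplex ℝ (Fin n → 𝒳) :=
    law_mem_stdSimplex (uniformLaw_mem_stdSimplex 𝒳 (m n)) _
  have hle : ((leakage pKZ (S n).Φ φ q : ℝ) : EReal) ≤ ε := by
    refine le_trans ?_ hleak
    refine le_trans ?_ (le_iSup₂_of_le M hM (le_iSup _ φ))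
    exact le_iSup₂ (f := fun q (_ : q ∈ stdSimplex ℝ (Fin n → 𝒳)) =>
      ((leakage pKZ (S n).Φ φ q : ℝ) : EReal)) q hqS
  rw [EReal.coe_le_coe_iff] at hle
  have hge := leakage_uniform_ge hpKZ (S n) φ Q hQ0 hQ1
  have h2 : n * (R - γ) ≤ (m n : ℝ) * Real.log (Fintype.card 𝒳) := by
    have := mul_le_mul_of_nonneg_left hrate.1 hnR.le
    have h3 : (n : ℝ) * ((m n : ℝ) / n * Real.log (Fintype.card 𝒳)) =
      m n * Real.log (Fintype.card 𝒳) := by field_simp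
    rwa [h3] at this
  have h4 : (n : ℝ) * (R - γ) - n * (R' + γ) = n * γ := by rw [hγ]; ring
  linarith

theorem mem_closure_of_forall_sub {A : Set (ℝ × ℝ)} {r : ℝ × ℝ}
    (h : ∀ᶠ s : ℝ in 𝓝[>] 0, (r.1 - s, r.2 - s) ∈ A) : r ∈ closure A := by
  refine mem_closure_of_tendsto (f := fun s : ℝ => (r.1 - s, r.2 - s)) (b := 𝓝[>] 0) ?_ h
  have : Tendsto (fun s : ℝ => (r.1 - s, r.2 - s)) (𝓝 0) (𝓝 (r.1 - 0, r.2 - 0)) :=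
    (by fun_prop : Continuous fun s : ℝ => (r.1 - s, r.2 - s)).tendsto 0
  simp only [sub_zero] at this
  exact this.mono_left nhdsWithin_le_nhds

theorem systemRegion_sub_notMem_akwRegion {ε δ : ℝ} {pX : 𝒳 → ℝ} {pKZ : 𝒳 × 𝒵 → ℝ}
    (hpKZ : pKZ ∈ stdSimplex ℝ (𝒳 × 𝒵)) {r : ℝ × ℝ} (hr : r ∈ systemRegion ε δ pX pKZ) {s : ℝ}
    (hs : 0 < s) : (r.1 - s, r.2 - s) ∉ akwRegion pKZ := fun hmem => by
  have := hr.2.not_lt hpKZ hr.1 hmem (sub_lt_self _ hs)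
  linarith

end Converse

end

end SideChannel

theorem theorem3 {𝒳 𝒵 : Type*} [Fintype 𝒳] [Fintype 𝒵]
    (pX : 𝒳 → ℝ) (hpX : pX ∈ stdSimplex ℝ 𝒳)
    (pKZ : 𝒳 × 𝒵 → ℝ) (hpKZ : pKZ ∈ stdSimplex ℝ (𝒳 × 𝒵))
    (ε₀ : ℝ) (hε₀ : 0 < ε₀) (ε δ : ℝ) (hε : ε ∈ Set.Ioc 0 ε₀) (hδ : δ ∈ Set.Ioo (0 : ℝ) 1) :
    SideChannel.systemRegion ε δ pX pKZ ⊆ closure (SideChannel.akwRegion pKZ)ᶜ ∧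
    ((∀ x, pX x ≠ 1) →
      SideChannel.systemRegion ε δ pX pKZ ⊆
        closure (SideChannel.quadrant \ SideChannel.akwRegion pKZ)) := by
  refine ⟨fun r hr => ?_, fun hne r hr => ?_⟩
  · refine SideChannel.mem_closure_of_forall_sub ?_
    filter_upwards [self_mem_nhdsWithin] with s hs
    exact SideChannel.systemRegion_sub_notMem_akwRegion hpKZ hr hs
  · have hR : 0 < r.2 := lt_of_le_of_ne hr.2.rate_nonneg (hr.2.rate_ne_zero hpX hne hδ.2).symm
    refine SideChannel.mem_closure_of_forall_sub ?_
    -- both coordinates are positive, so a small diagonal step stays in the quadrant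
    filter_upwards [self_mem_nhdsWithin, nhdsWithin_le_nhds (Iio_mem_nhds hr.1),
      nhdsWithin_le_nhds (Iio_mem_nhds hR)] with s hs h1 h2
    exact ⟨⟨sub_nonneg.2 (le_of_lt h1), sub_nonneg.2 (le_of_lt h2)⟩,
      SideChannel.systemRegion_sub_notMem_akwRegion hpKZ hr hs⟩
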